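/- Let $P_n=\sum_{i=1}^n i^2$ be the $n$-th square pyramidal number, let $a_n=\min_{y\in\mathbb{Z}}|P_n-y^2|$ be the distance from $P_n$ to the closest perfect square, and let $b_n=\sum_{d\mid n}a_d$. Then for every $\delta>0$ and every real $x\ge 1$, $$x\sum_{1\le n\le x}b_n\left(1-\frac{n}{x}\right)=\frac{2\,\zeta(5/2)}{35\sqrt3}\,x^{7/2}+O_\delta\!\left(x^{41/12+\delta}\right),$$ where $\zeta$ is the Riemann zeta function and the implied constant depends only on $\delta$. Equivalently, $\sum_{1\le n\le x}b_n\left(1-\frac nx\right)=\frac{2\,\zeta(5/2)}{35\sqrt3}\,x^{5/2}+O_\delta\!\left(x^{29/12+\delta}\right)$. -/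

import Mathlib

namespace Cannonball

/-- The `n`-th square pyramidal number `1² + 2² + ⋯ + n²`. -/
def pyramidal (n : ℕ) : ℕ := ∑ i ∈ Finset.Icc 1 n, i ^ 2

/-- The distance `|P_n - y_n²|` from the `n`-th square pyramidal number `P_n` to the closest perfect
square, i.e. the smallest of the values `|P_n - y²|`, `y = 0, 1, 2, …` (see `exists_a_eq`). -/
noncomputable def a (n : ℕ) : ℕ :=
  sInf (Set.range fun y : ℕ => ((pyramidal n : ℤ) - (y : ℤ) ^ 2).natAbs)

/-- `b_n = ∑_{d ∣ n} a_d`, the sum being over the positive divisors of `n`. -/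
noncomputable def b (n : ℕ) : ℕ := ∑ d ∈ n.divisors, a d

/-- The closed form of the square pyramidal numbers. -/
theorem six_mul_pyramidal (n : ℕ) : 6 * pyramidal n = 2 * n ^ 3 + 3 * n ^ 2 + n := by
  induction n with
  | zero => simp [pyramidal]
  | succ k ih =>
    have h : pyramidal (k + 1) = pyramidal k + (k + 1) ^ 2 := by
      simp [pyramidal, Finset.sum_Icc_succ_top]
    rw [h, mul_add, ih]
    ring

/-- `a n` is the distance from `P_n` to a square `y²` that is closest to `P_n`. -/
theorem exists_a_eq (n : ℕ) : ∃ y : ℕ, (a n : ℤ) = |(pyramidal n : ℤ) - (y : ℤ) ^ 2| ∧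
    ∀ z : ℕ, |(pyramidal n : ℤ) - (y : ℤ) ^ 2| ≤ |(pyramidal n : ℤ) - (z : ℤ) ^ 2| := by
  obtain ⟨y, hy⟩ := Nat.sInf_mem
    (Set.range_nonempty fun y : ℕ => ((pyramidal n : ℤ) - (y : ℤ) ^ 2).natAbs)
  have hy' : (a n : ℤ) = |(pyramidal n : ℤ) - (y : ℤ) ^ 2| := by
    rw [Int.abs_eq_natAbs]
    exact congrArg Nat.cast hy.symm
  refine ⟨y, hy', fun z => ?_⟩
  rw [← hy', Int.abs_eq_natAbs]
  exact Int.ofNat_le.mpr (Nat.sInf_le ⟨z, rfl⟩)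

end Cannonball

/-! Write `s` for the square root of `P_n` and ‖·‖ for the distance to the nearest integer.
Factoring `P_n - y²` gives `a n = 2s‖s‖ + O(1)`, and `s` is close to the smooth function `pyrRoot n
= (n + 1/2)^(3/2)/√3`. The values `pyrRoot n` equidistribute modulo 1, so ‖·‖ may be replaced by its
mean 1/4. This yields `a n ≈ n^(3/2)/(2√3)` on average and, with the weight `1 - n/X`, the constant
`(2/5 - 2/7)/(2√3) = 2/(35√3)`.

The error comes from `∑_{n<N} (‖pyrRoot n‖ - 1/4) = O(N^(11/12))`
(`exists_abs_sum_dist_pyrRoot_le`). The Fourier coefficients of ‖·‖ are `O(k⁻²)`, and the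
exponential sums with phase `k * pyrRoot n` are bounded by one van der Corput differencing followed
by a Kusmin–Landau estimate. Partial summation against weights of size `X^(3/2)` gives `X^(29/12)`
(`exists_abs_sum_a_sub_le`).

Since `b = a * 1` as a Dirichlet convolution, the weighted sum of `b` is the sum over `m` of the
weighted sums of `a` at `x/m`. The main terms assemble into `ζ(5/2)`, and the errors converge
because `29/12 > 1`. -/

open Finset

/-! ### Exponential sums: Kusmin–Landau and van der Corput. -/

/-- The additive character `exp (2πix)` of `ℝ / ℤ`. -/
noncomputable def unitExp (x : ℝ) : ℂ := Complex.exp (Complex.I * ((2 * Real.pi * x : ℝ) : ℂ))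

theorem norm_unitExp (x : ℝ) : ‖unitExp x‖ = 1 := by
  rw [unitExp, mul_comm, Complex.norm_exp_ofReal_mul_I]

theorem unitExp_add (x y : ℝ) : unitExp (x + y) = unitExp x * unitExp y := by
  rw [unitExp, unitExp, unitExp, ← Complex.exp_add]
  push_cast
  ring_nf

theorem unitExp_mul_conj (x y : ℝ) :
    unitExp x * (starRingEnd ℂ) (unitExp y) = unitExp (x - y) := by
  simp only [unitExp, ← Complex.exp_conj, ← Complex.exp_add, map_mul, Complex.conj_I,
    Complex.conj_ofReal]
  push_cast
  ring_nf

theorem re_unitExp (x : ℝ) : (unitExp x).re = Real.cos (2 * Real.pi * x) := by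
  rw [unitExp, mul_comm, Complex.exp_ofReal_mul_I_re]

theorem four_mul_le_norm_unitExp_sub_one {d : ℝ} (h0 : 0 ≤ d) (h1 : d ≤ 1 / 2) :
    4 * d ≤ ‖unitExp d - 1‖ := by
  rw [unitExp, Complex.norm_exp_I_mul_ofReal_sub_one]
  have hpi := Real.pi_pos
  have h := Real.mul_le_sin (x := Real.pi * d) (by positivity) (by nlinarith)
  have e : 2 / Real.pi * (Real.pi * d) = 2 * d := by field_simp
  rw [e] at h
  have e2 : 2 * Real.pi * d / 2 = Real.pi * d := by ring
  rw [e2, Real.norm_eq_abs]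
  exact le_trans (by linarith) (le_abs_self _)

theorem norm_unitExp_sub_le (x y : ℝ) : ‖unitExp x - unitExp y‖ ≤ 2 * Real.pi * |x - y| := by
  have e : unitExp x - unitExp y = unitExp y * (unitExp (x - y) - 1) := by
    rw [mul_sub, ← unitExp_add]
    simp
  rw [e, norm_mul, norm_unitExp, one_mul, unitExp]
  refine (Real.norm_exp_I_mul_ofReal_sub_one_le).trans ?_
  rw [Real.norm_eq_abs, abs_mul, abs_of_pos (by positivity : 0 < 2 * Real.pi)]

/-- A Kusmin–Landau type bound: exponential sums whose phase has slowly decreasing increments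
in `[l, 1/2]`. -/
theorem norm_sum_unitExp_le (φ : ℕ → ℝ) {M N : ℕ} {l : ℝ} (hl : 0 < l) (hMN : M ≤ N)
    (hlow : ∀ n, M ≤ n → n ≤ N → l ≤ φ (n + 1) - φ n)
    (hup : ∀ n, M ≤ n → n ≤ N → φ (n + 1) - φ n ≤ 1 / 2)
    (hanti : ∀ n, M ≤ n → φ (n + 2) - φ (n + 1) ≤ φ (n + 1) - φ n) :
    ‖∑ n ∈ Ico M N, unitExp (φ n)‖ ≤ 1 / (2 * l) + (φ (M + 1) - φ M) / (2 * l ^ 2) := by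
  set d : ℕ → ℝ := fun n => φ (n + 1) - φ n with hd
  -- With this `v`, `unitExp (φ n) = (unitExp (φ (n + 1)) - unitExp (φ n)) * v n`, which prepares
  -- summation by parts. The variation of `v` is controlled by that of the monotone `d`.
  set v : ℕ → ℂ := fun n => (unitExp (d n) - 1)⁻¹ with hv
  have hw : ∀ n, M ≤ n → n ≤ N → 4 * l ≤ ‖unitExp (d n) - 1‖ := fun n h1 h2 =>
    le_trans (by linarith [hlow n h1 h2])
      (four_mul_le_norm_unitExp_sub_one (hl.le.trans (hlow n h1 h2)) (hup n h1 h2))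
  have hw0 : ∀ n, M ≤ n → n ≤ N → unitExp (d n) - 1 ≠ 0 := fun n h1 h2 h => by
    have := hw n h1 h2
    rw [h, norm_zero] at this
    linarith
  have hvn : ∀ n, M ≤ n → n ≤ N → ‖v n‖ ≤ 1 / (4 * l) := fun n h1 h2 => by
    rw [hv, norm_inv, ← one_div]
    exact one_div_le_one_div_of_le (by positivity) (hw n h1 h2)
  have hvd : ∀ n, M ≤ n → n + 1 ≤ N → ‖v n - v (n + 1)‖ ≤ (d n - d (n + 1)) / (2 * l ^ 2) := by
    intro n h1 h2
    have ha := hw0 n h1 (by omega)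
    have hb := hw0 (n + 1) (by omega) h2
    have hda : d (n + 1) ≤ d n := hanti n h1
    have e : v n - v (n + 1) = (unitExp (d (n + 1)) - unitExp (d n)) * (v n * v (n + 1)) := by
      simp only [hv]
      field_simp
      ring
    rw [e, norm_mul, norm_mul]
    have h3 := norm_unitExp_sub_le (d (n + 1)) (d n)
    rw [abs_sub_comm, abs_of_nonneg (by linarith)] at h3
    have h4 : ‖v n‖ * ‖v (n + 1)‖ ≤ 1 / (4 * l) * (1 / (4 * l)) :=
      mul_le_mul (hvn n h1 (by omega)) (hvn _ (by omega) h2) (norm_nonneg _) (by positivity)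
    calc _ ≤ (2 * Real.pi * (d n - d (n + 1))) * (1 / (4 * l) * (1 / (4 * l))) :=
          mul_le_mul h3 h4 (by positivity)
            (mul_nonneg (by positivity) (by linarith))
      _ = (Real.pi / 4) * ((d n - d (n + 1)) / (2 * l ^ 2)) := by field_simp; ring
      _ ≤ 1 * ((d n - d (n + 1)) / (2 * l ^ 2)) := by
          refine mul_le_mul_of_nonneg_right (by linarith [Real.pi_le_four]) ?_
          exact div_nonneg (by linarith) (by positivity)
      _ = _ := one_mul _
  have key : ∀ K, M ≤ K → K ≤ N →
      ‖∑ n ∈ Ico M K, unitExp (φ n) - (unitExp (φ K) * v K - unitExp (φ M) * v M)‖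
        ≤ (d M - d K) / (2 * l ^ 2) := by
    intro K hK
    induction K, hK using Nat.le_induction with
    | base => intro _; simp
    | succ K hK ih =>
      intro hKN
      have h1 := ih (by omega)
      have h2 := hvd K hK hKN
      have hu : unitExp (φ (K + 1)) = unitExp (φ K) * unitExp (d K) := by
        rw [← unitExp_add]
        simp [hd]
      have hz := hw0 K hK (by omega)
      have e : ∑ n ∈ Ico M (K + 1), unitExp (φ n)
          - (unitExp (φ (K + 1)) * v (K + 1) - unitExp (φ M) * v M)
          = (∑ n ∈ Ico M K, unitExp (φ n) - (unitExp (φ K) * v K - unitExp (φ M) * v M))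
            + unitExp (φ (K + 1)) * (v K - v (K + 1)) := by
        rw [sum_Ico_succ_top hK]
        have : unitExp (φ K) + unitExp (φ K) * v K = unitExp (φ (K + 1)) * v K := by
          rw [hu]
          simp only [hv]
          field_simp
          ring
        linear_combination this
      rw [e]
      refine (norm_add_le _ _).trans ?_
      rw [norm_mul, norm_unitExp, one_mul]
      refine (add_le_add h1 h2).trans (le_of_eq ?_)
      ring
  have h := key N hMN le_rfl
  have hb : ‖unitExp (φ N) * v N - unitExp (φ M) * v M‖ ≤ 1 / (2 * l) := by
    refine (norm_sub_le _ _).trans ?_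
    rw [norm_mul, norm_mul, norm_unitExp, norm_unitExp, one_mul, one_mul]
    refine (add_le_add (hvn N hMN le_rfl) (hvn M le_rfl hMN)).trans (le_of_eq ?_)
    field_simp
    norm_num
  have hdN : 0 ≤ d N := hl.le.trans (hlow N hMN le_rfl)
  have hle : (d M - d N) / (2 * l ^ 2) ≤ d M / (2 * l ^ 2) := by
    gcongr
    linarith
  have := norm_le_norm_add_norm_sub' (∑ n ∈ Ico M N, unitExp (φ n))
    (unitExp (φ N) * v N - unitExp (φ M) * v M)
  change _ ≤ 1 / (2 * l) + d M / (2 * l ^ 2)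
  linarith

/-- Each unit shift of the window replaces one end term by another, at a cost of at most 2. -/
theorem norm_sum_Ico_sub_sum_shift_le (z : ℕ → ℂ) (hz : ∀ n, ‖z n‖ ≤ 1) {M N : ℕ} (hMN : M ≤ N)
    (j : ℕ) : ‖∑ n ∈ Ico M N, z n - ∑ n ∈ Ico M N, z (n + j)‖ ≤ 2 * j := by
  induction j with
  | zero => simp
  | succ j ih =>
    have h1 : ∑ n ∈ Ico M N, z (n + j) - ∑ n ∈ Ico M N, z (n + (j + 1)) = z (M + j) - z (N + j) := by
      have := sum_Ico_sub (fun n => z (n + j)) hMN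
      rw [← neg_sub (z (N + j)), ← this, ← sum_sub_distrib, ← sum_neg_distrib]
      refine sum_congr rfl fun n _ => ?_
      rw [neg_sub]
      congr 2
      omega
    calc _ = ‖(∑ n ∈ Ico M N, z n - ∑ n ∈ Ico M N, z (n + j)) + (z (M + j) - z (N + j))‖ := by
          rw [← h1]; congr 1; ring
      _ ≤ 2 * j + (1 + 1) := by
          refine (norm_add_le _ _).trans (add_le_add ih ((norm_sub_le _ _).trans ?_))
          exact add_le_add (hz _) (hz _)
      _ = _ := by push_cast; ring

/-- Van der Corput's inequality, for bounded correlations. -/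
theorem norm_sum_Ico_le_of_correlations (z : ℕ → ℂ) (hz : ∀ n, ‖z n‖ ≤ 1) {M N H : ℕ}
    (hMN : M ≤ N) (hH : 0 < H) {B : ℝ} (hB0 : 0 ≤ B)
    (hB : ∀ i j, i < j → j < H →
      ‖∑ n ∈ Ico M N, z (n + j) * (starRingEnd ℂ) (z (n + i))‖ ≤ B) :
    ‖∑ n ∈ Ico M N, z n‖ ≤ Real.sqrt ((N : ℝ) ^ 2 / H + N * B) + 2 * H := by
  set S := ∑ n ∈ Ico M N, z n with hS
  set T := ∑ n ∈ Ico M N, ∑ j ∈ range H, z (n + j) with hT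
  have hHr : (0 : ℝ) < H := by exact_mod_cast hH
  have hcard : ((Ico M N).card : ℝ) ≤ N := by
    rw [Nat.card_Ico]
    exact_mod_cast Nat.sub_le _ _
  -- `T` sums `H` shifted copies of `S`, each within `2 * H` of `S`. Cauchy–Schwarz on `T` then
  -- brings in the correlations; the diagonal ones are bounded trivially by `N`.
  have hST : ‖(H : ℂ) * S - T‖ ≤ H * (2 * H) := by
    have e : (H : ℂ) * S - T = ∑ j ∈ range H, (S - ∑ n ∈ Ico M N, z (n + j)) := by
      rw [sum_sub_distrib, hT, sum_comm]
      simp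
    rw [e]
    refine (norm_sum_le_of_le _ (f := fun j => S - ∑ n ∈ Ico M N, z (n + j))
      (n := fun _ => 2 * (H : ℝ)) fun j hj => ?_).trans (by simp)
    refine (norm_sum_Ico_sub_sum_shift_le z hz hMN j).trans ?_
    have : (j : ℝ) ≤ H := by exact_mod_cast (mem_range.1 hj).le
    linarith
  have hcorr : ∀ i ∈ range H, ∀ j ∈ range H,
      ‖∑ n ∈ Ico M N, z (n + i) * (starRingEnd ℂ) (z (n + j))‖
        ≤ (if i = j then (N : ℝ) else 0) + B := by
    intro i hi j hj
    rcases lt_trichotomy i j with h | h | h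
    · rw [if_neg h.ne, zero_add]
      refine le_trans (le_of_eq ?_) (hB i j h (mem_range.1 hj))
      rw [← Complex.norm_conj, map_sum]
      congr 1
      refine sum_congr rfl fun n _ => ?_
      simp [mul_comm]
    · rw [if_pos h, h]
      refine le_trans ((norm_sum_le_of_le _ (n := fun _ => (1 : ℝ)) fun n _ => ?_).trans ?_)
        (le_add_of_nonneg_right hB0)
      · rw [norm_mul, Complex.norm_conj]
        exact mul_le_one₀ (hz _) (norm_nonneg _) (hz _)
      · rw [sum_const, nsmul_eq_mul, mul_one]
        exact hcard
    · rw [if_neg h.ne', zero_add]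
      exact hB j i h (mem_range.1 hi)
  have hsq : ∑ n ∈ Ico M N, ‖∑ j ∈ range H, z (n + j)‖ ^ 2 ≤ H * N + H ^ 2 * B := by
    have e : ((∑ n ∈ Ico M N, ‖∑ j ∈ range H, z (n + j)‖ ^ 2 : ℝ) : ℂ)
        = ∑ i ∈ range H, ∑ j ∈ range H,
            ∑ n ∈ Ico M N, z (n + i) * (starRingEnd ℂ) (z (n + j)) := by
      have e1 : ∀ i ∈ range H, (∑ j ∈ range H,
          ∑ n ∈ Ico M N, z (n + i) * (starRingEnd ℂ) (z (n + j)))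
          = ∑ n ∈ Ico M N, ∑ j ∈ range H, z (n + i) * (starRingEnd ℂ) (z (n + j)) :=
        fun i _ => sum_comm
      rw [sum_congr rfl e1, sum_comm]
      push_cast
      refine sum_congr rfl fun n _ => ?_
      rw [← Complex.mul_conj', map_sum, sum_mul_sum]
    have h0 : 0 ≤ ∑ n ∈ Ico M N, ‖∑ j ∈ range H, z (n + j)‖ ^ 2 :=
      sum_nonneg fun _ _ => by positivity
    rw [← abs_of_nonneg h0, ← Real.norm_eq_abs, ← Complex.norm_real, e]
    refine (norm_sum_le_of_le _ fun i hi => norm_sum_le_of_le _ fun j hj =>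
      hcorr i hi j hj).trans (le_of_eq ?_)
    simp only [sum_add_distrib, sum_ite_eq, sum_const, card_range, nsmul_eq_mul]
    rw [sum_congr rfl fun i hi => if_pos hi]
    simp only [sum_const, card_range, nsmul_eq_mul]
    ring
  have hTsq : ‖T‖ ^ 2 ≤ N * (H * N + H ^ 2 * B) := by
    calc ‖T‖ ^ 2 ≤ (∑ n ∈ Ico M N, ‖∑ j ∈ range H, z (n + j)‖) ^ 2 := by
          gcongr
          exact norm_sum_le _ _
      _ ≤ (Ico M N).card * ∑ n ∈ Ico M N, ‖∑ j ∈ range H, z (n + j)‖ ^ 2 :=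
          sq_sum_le_card_mul_sum_sq
      _ ≤ _ := by gcongr
  have hT' : ‖T‖ ≤ H * Real.sqrt ((N : ℝ) ^ 2 / H + N * B) := by
    refine abs_le_of_sq_le_sq' ?_ (by positivity) |>.2
    rw [mul_pow, Real.sq_sqrt (by positivity)]
    refine hTsq.trans (le_of_eq ?_)
    field_simp
  have h := norm_le_norm_add_norm_sub' ((H : ℂ) * S) T
  rw [norm_mul, Complex.norm_natCast] at h
  refine le_of_mul_le_mul_left (h.trans ?_) hHr
  rw [mul_add]
  exact add_le_add hT' hST

/-! ### The smooth phase `pyrRoot` and its finite differences. -/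

/-- A smooth approximation, within `O(t ^ (-1/2))`, of the square root of the `t`-th square
pyramidal number. -/
noncomputable def pyrRoot (t : ℝ) : ℝ := (t + 1 / 2) ^ (3 / 2 : ℝ) / Real.sqrt 3

theorem hasDerivAt_pyrRoot {t : ℝ} (ht : 0 ≤ t) :
    HasDerivAt pyrRoot (Real.sqrt 3 / 2 * Real.sqrt (t + 1 / 2)) t := by
  have h := (((hasDerivAt_id t).add_const (1 / 2)).rpow_const (p := 3 / 2)
    (Or.inr (by norm_num))).div_const (Real.sqrt 3)
  convert! h using 1
  have h3 : Real.sqrt 3 ^ 2 = 3 := Real.sq_sqrt (by norm_num)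
  rw [show (3 / 2 : ℝ) - 1 = 1 / 2 by norm_num, ← Real.sqrt_eq_rpow]
  simp only [id]
  field_simp
  rw [h3]

/-- Mean value theorem for `s ↦ pyrRoot (s + 1) - pyrRoot s`. The remaining difference of square
roots has size `1/√ξ`, because its product with their sum is 1. -/
theorem exists_pyrRoot_second_diff_eq {t h : ℝ} (ht : 0 ≤ t) (hh : 0 < h) :
    ∃ ξ ∈ Set.Ioo t (t + h), (pyrRoot (t + h + 1) - pyrRoot (t + h)) - (pyrRoot (t + 1) - pyrRoot t)
      = Real.sqrt 3 / 2 * h * (Real.sqrt (ξ + 3 / 2) - Real.sqrt (ξ + 1 / 2)) := by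
  have hder : ∀ s, 0 ≤ s → HasDerivAt (fun s => pyrRoot (s + 1) - pyrRoot s)
      (Real.sqrt 3 / 2 * Real.sqrt (s + 1 + 1 / 2) - Real.sqrt 3 / 2 * Real.sqrt (s + 1 / 2)) s := by
    intro s hs
    exact (HasDerivAt.comp_add_const s 1 (hasDerivAt_pyrRoot (by linarith))).sub
      (hasDerivAt_pyrRoot hs)
  obtain ⟨ξ, hξ, e⟩ := exists_hasDerivAt_eq_slope (fun s => pyrRoot (s + 1) - pyrRoot s) _
    (by linarith : t < t + h)
    (fun s hs => (hder s (ht.trans hs.1)).continuousAt.continuousWithinAt)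
    (fun s hs => hder s (ht.trans hs.1.le))
  refine ⟨ξ, hξ, ?_⟩
  rw [eq_div_iff (by linarith)] at e
  rw [← e, show ξ + 1 + 1 / 2 = ξ + 3 / 2 by ring]
  ring

theorem pyrRoot_second_diff_le {t h : ℝ} (ht : 0 ≤ t) (hh : 0 < h) :
    (pyrRoot (t + h + 1) - pyrRoot (t + h)) - (pyrRoot (t + 1) - pyrRoot t)
      ≤ h / (2 * Real.sqrt (t + 1 / 2)) := by
  obtain ⟨ξ, hξ, e⟩ := exists_pyrRoot_second_diff_eq ht hh
  rw [e, le_div_iff₀ (mul_pos two_pos (Real.sqrt_pos.2 (by linarith)))]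
  have h3 : Real.sqrt 3 ≤ 2 := by rw [Real.sqrt_le_left (by norm_num)]; norm_num
  have hξ0 : 0 ≤ ξ := ht.trans hξ.1.le
  have h1 : Real.sqrt (t + 1 / 2) ≤ Real.sqrt (ξ + 1 / 2) := Real.sqrt_le_sqrt (by linarith [hξ.1])
  have h2 : Real.sqrt (ξ + 1 / 2) ≤ Real.sqrt (ξ + 3 / 2) := Real.sqrt_le_sqrt (by linarith)
  have ha : Real.sqrt (ξ + 1 / 2) ^ 2 = ξ + 1 / 2 := Real.sq_sqrt (by linarith)
  have hb : Real.sqrt (ξ + 3 / 2) ^ 2 = ξ + 3 / 2 := Real.sq_sqrt (by linarith)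
  have h0 := Real.sqrt_nonneg (t + 1 / 2)
  have hp : (Real.sqrt (ξ + 3 / 2) - Real.sqrt (ξ + 1 / 2)) * (2 * Real.sqrt (t + 1 / 2)) ≤ 1 := by
    nlinarith
  calc _ = Real.sqrt 3 / 2 * h * ((Real.sqrt (ξ + 3 / 2) - Real.sqrt (ξ + 1 / 2)) *
        (2 * Real.sqrt (t + 1 / 2))) := by ring
    _ ≤ 1 * h * 1 := by
      refine mul_le_mul (mul_le_mul_of_nonneg_right (by linarith) hh.le) hp
        (mul_nonneg (by linarith) (by linarith)) (by linarith)
    _ = h := by ring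

theorem le_pyrRoot_second_diff {t h : ℝ} (ht : 0 ≤ t) (hh : 0 < h) :
    h / (4 * Real.sqrt (t + h + 3 / 2)) ≤
      (pyrRoot (t + h + 1) - pyrRoot (t + h)) - (pyrRoot (t + 1) - pyrRoot t) := by
  obtain ⟨ξ, hξ, e⟩ := exists_pyrRoot_second_diff_eq ht hh
  rw [e, div_le_iff₀ (mul_pos (by norm_num) (Real.sqrt_pos.2 (by linarith)))]
  have h3 : 1 ≤ Real.sqrt 3 := by rw [Real.one_le_sqrt]; norm_num
  have hξ0 : 0 ≤ ξ := ht.trans hξ.1.le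
  have h1 : Real.sqrt (ξ + 3 / 2) ≤ Real.sqrt (t + h + 3 / 2) :=
    Real.sqrt_le_sqrt (by linarith [hξ.2])
  have h2 : Real.sqrt (ξ + 1 / 2) ≤ Real.sqrt (ξ + 3 / 2) := Real.sqrt_le_sqrt (by linarith)
  have ha : Real.sqrt (ξ + 1 / 2) ^ 2 = ξ + 1 / 2 := Real.sq_sqrt (by linarith)
  have hb : Real.sqrt (ξ + 3 / 2) ^ 2 = ξ + 3 / 2 := Real.sq_sqrt (by linarith)
  have h0 := Real.sqrt_nonneg (ξ + 1 / 2)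
  have hp : 1 ≤ (Real.sqrt (ξ + 3 / 2) - Real.sqrt (ξ + 1 / 2)) *
      (2 * Real.sqrt (t + h + 3 / 2)) := by
    nlinarith
  calc h = 1 * h * 1 := by ring
    _ ≤ Real.sqrt 3 * h * ((Real.sqrt (ξ + 3 / 2) - Real.sqrt (ξ + 1 / 2)) *
        (2 * Real.sqrt (t + h + 3 / 2))) := by gcongr
    _ = _ := by ring

/-- The derivative is a positive multiple of a second difference of the concave function √. -/
theorem antitoneOn_pyrRoot_third_diff :
    AntitoneOn (fun t => (pyrRoot (t + 1 + 1) - pyrRoot (t + 1)) - (pyrRoot (t + 1) - pyrRoot t))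
      (Set.Ici 0) := by
  have hder : ∀ s, 0 ≤ s → HasDerivAt
      (fun t => (pyrRoot (t + 1 + 1) - pyrRoot (t + 1)) - (pyrRoot (t + 1) - pyrRoot t))
      ((Real.sqrt 3 / 2 * Real.sqrt (s + 1 + 1 + 1 / 2) - Real.sqrt 3 / 2 * Real.sqrt (s + 1 + 1 / 2))
        - (Real.sqrt 3 / 2 * Real.sqrt (s + 1 + 1 / 2) - Real.sqrt 3 / 2 * Real.sqrt (s + 1 / 2)))
      s := by
    intro s hs
    have h1 := HasDerivAt.comp_add_const s 1 (hasDerivAt_pyrRoot (by linarith : 0 ≤ s + 1))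
    have h2 := HasDerivAt.comp_add_const s 1 (HasDerivAt.comp_add_const (s + 1) 1
      (hasDerivAt_pyrRoot (by linarith : 0 ≤ s + 1 + 1)))
    exact (h2.sub h1).sub (h1.sub (hasDerivAt_pyrRoot hs))
  refine antitoneOn_of_deriv_nonpos (convex_Ici 0)
    (fun s hs => (hder s hs).continuousAt.continuousWithinAt) ?_ ?_
  · intro s hs
    rw [interior_Ici] at hs
    exact (hder s (le_of_lt hs)).differentiableAt.differentiableWithinAt
  · intro s hs
    rw [interior_Ici] at hs
    have hs0 : 0 < s := hs
    rw [(hder s hs0.le).deriv]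
    have ha : Real.sqrt (s + 1 + 1 + 1 / 2) ^ 2 = s + 1 + 1 + 1 / 2 := Real.sq_sqrt (by linarith)
    have hb : Real.sqrt (s + 1 + 1 / 2) ^ 2 = s + 1 + 1 / 2 := Real.sq_sqrt (by linarith)
    have hc : Real.sqrt (s + 1 / 2) ^ 2 = s + 1 / 2 := Real.sq_sqrt (by linarith)
    have key : Real.sqrt (s + 1 + 1 + 1 / 2) + Real.sqrt (s + 1 / 2)
        ≤ 2 * Real.sqrt (s + 1 + 1 / 2) := by
      refine abs_le_of_sq_le_sq' ?_ (by positivity) |>.2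
      nlinarith [sq_nonneg (Real.sqrt (s + 1 + 1 + 1 / 2) - Real.sqrt (s + 1 / 2))]
    have h3 := Real.sqrt_nonneg 3
    nlinarith

/-- Supplies the decreasing increments required by `norm_sum_unitExp_le` for the differenced phase.
After rearrangement it compares the second difference with step 1 at `t + h` and at `t`. -/
theorem pyrRoot_second_diff_antitone {t : ℝ} (h : ℝ) (ht : 0 ≤ t) (hh : 0 ≤ h) :
    (pyrRoot (t + 1 + h + 1) - pyrRoot (t + 1 + h)) - (pyrRoot (t + 1 + 1) - pyrRoot (t + 1))
      ≤ (pyrRoot (t + h + 1) - pyrRoot (t + h)) - (pyrRoot (t + 1) - pyrRoot t) := by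
  have := antitoneOn_pyrRoot_third_diff (Set.mem_Ici.2 ht)
    (Set.mem_Ici.2 (by linarith : 0 ≤ t + h)) (by linarith)
  simp only at this
  rw [show t + 1 + h = t + h + 1 by ring]
  linarith

/-! ### Exponential sums along `pyrRoot`. -/

/-- With `g = j - i`, the differenced phase has increments of order `k * g / √n`. Starting at `Q ^
11` keeps them below `Q ^ 4 / (2 * Q ^ 5) ≤ 1/2`, and `n ≤ N` keeps them above a multiple of `k * g
/ Q ^ 6`. Kusmin–Landau then gives `O(Q ^ 7)`, more than enough here. -/
theorem norm_sum_unitExp_pyrRoot_correlation_le {k Q N i j : ℕ} (hk : 1 ≤ k) (hkQ : k ≤ Q ^ 2)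
    (hQ : 1 ≤ Q) (hN : Q ^ 12 ≤ N) (hN' : N ≤ 4096 * Q ^ 12) (hij : i < j) (hj : j < Q ^ 2) :
    ‖∑ n ∈ Ico (Q ^ 11) N, unitExp (k * pyrRoot ((n + j : ℕ) : ℝ)) *
      (starRingEnd ℂ) (unitExp (k * pyrRoot ((n + i : ℕ) : ℝ)))‖ ≤ 20000 * (Q : ℝ) ^ 10 := by
  simp only [unitExp_mul_conj]
  obtain ⟨h, rfl⟩ := Nat.exists_eq_add_of_lt hij
  have hkr : (1 : ℝ) ≤ k := by exact_mod_cast hk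
  have hQr : (1 : ℝ) ≤ Q := by exact_mod_cast hQ
  have hkQr : (k : ℝ) ≤ (Q : ℝ) ^ 2 := by exact_mod_cast hkQ
  have hNr : (N : ℝ) ≤ 4096 * (Q : ℝ) ^ 12 := by exact_mod_cast hN'
  have hjr : (i : ℝ) + h + 1 ≤ (Q : ℝ) ^ 2 := by exact_mod_cast hj.le
  set g : ℝ := (h : ℝ) + 1 with hg
  have hg1 : 1 ≤ g := by rw [hg]; linarith [(Nat.cast_nonneg h : (0 : ℝ) ≤ h)]
  have hi0 : (0 : ℝ) ≤ i := Nat.cast_nonneg i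
  have hgQ : g ≤ (Q : ℝ) ^ 2 := by rw [hg]; linarith
  have hdiff : ∀ n : ℕ,
      ((k : ℝ) * pyrRoot ((n + 1 + (i + h + 1) : ℕ) : ℝ) - k * pyrRoot ((n + 1 + i : ℕ) : ℝ))
      - (k * pyrRoot ((n + (i + h + 1) : ℕ) : ℝ) - k * pyrRoot ((n + i : ℕ) : ℝ))
      = k * ((pyrRoot ((n : ℝ) + i + g + 1) - pyrRoot ((n : ℝ) + i + g))
          - (pyrRoot ((n : ℝ) + i + 1) - pyrRoot ((n : ℝ) + i))) := by
    intro n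
    push_cast
    rw [show (n : ℝ) + 1 + (i + h + 1) = n + i + g + 1 by rw [hg]; ring,
      show (n : ℝ) + (i + h + 1) = n + i + g by rw [hg]; ring,
      show (n : ℝ) + 1 + i = n + i + 1 by ring]
    ring
  have hpow : ∀ n : ℕ, Q ^ 11 ≤ n → (Q : ℝ) ^ 5 ≤ Real.sqrt ((n : ℝ) + i + 1 / 2) := by
    intro n hn
    have hn' : (Q : ℝ) ^ 11 ≤ n := by exact_mod_cast hn
    refine Real.le_sqrt_of_sq_le ?_
    have : ((Q : ℝ) ^ 5) ^ 2 ≤ (Q : ℝ) ^ 11 := by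
      rw [← pow_mul]
      exact pow_le_pow_right₀ hQr (by norm_num)
    linarith
  have hupper : ∀ n : ℕ, Q ^ 11 ≤ n →
      k * ((pyrRoot ((n : ℝ) + i + g + 1) - pyrRoot ((n : ℝ) + i + g))
          - (pyrRoot ((n : ℝ) + i + 1) - pyrRoot ((n : ℝ) + i))) ≤ k * g / (2 * (Q : ℝ) ^ 5) := by
    intro n hn
    rw [mul_div_assoc]
    refine mul_le_mul_of_nonneg_left ?_ (by linarith)
    refine (pyrRoot_second_diff_le (by positivity) (by linarith)).trans ?_
    have := hpow n hn
    gcongr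
  -- `260 = 4 * 65`, where `65 * Q ^ 6` bounds the square root in `le_pyrRoot_second_diff`, as `65²
  -- > 4096 + 5/2`.
  set l : ℝ := k * g / (260 * (Q : ℝ) ^ 6) with hl
  have hl0 : 0 < l := by positivity
  have hlower : ∀ n : ℕ, n ≤ N → l ≤
      k * ((pyrRoot ((n : ℝ) + i + g + 1) - pyrRoot ((n : ℝ) + i + g))
          - (pyrRoot ((n : ℝ) + i + 1) - pyrRoot ((n : ℝ) + i))) := by
    intro n hn
    have hn' : (n : ℝ) ≤ N := by exact_mod_cast hn
    rw [hl, mul_div_assoc]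
    refine mul_le_mul_of_nonneg_left ?_ (by linarith)
    refine le_trans ?_ (le_pyrRoot_second_diff (by positivity) (by linarith))
    have hs : Real.sqrt ((n : ℝ) + i + g + 3 / 2) ≤ 65 * (Q : ℝ) ^ 6 := by
      refine Real.sqrt_le_iff.2 ⟨by positivity, ?_⟩
      have h2 : (Q : ℝ) ^ 2 ≤ (Q : ℝ) ^ 12 := pow_le_pow_right₀ hQr (by norm_num)
      have h3 : (1 : ℝ) ≤ (Q : ℝ) ^ 12 := one_le_pow₀ hQr
      nlinarith
    have hs0 : 0 < Real.sqrt ((n : ℝ) + i + g + 3 / 2) := Real.sqrt_pos.2 (by positivity)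
    refine div_le_div_of_nonneg_left (by linarith) (by linarith) (by linarith)
  have hMN : Q ^ 11 ≤ N := (Nat.pow_le_pow_right hQ (by norm_num)).trans hN
  have main := norm_sum_unitExp_le
    (fun n => (k : ℝ) * pyrRoot ((n + (i + h + 1) : ℕ) : ℝ) - k * pyrRoot ((n + i : ℕ) : ℝ))
    hl0 hMN (fun n _ h2 => by simp only [hdiff]; exact hlower n h2)
    (fun n h1 _ => by
      simp only [hdiff]
      refine (hupper n h1).trans ?_
      rw [div_le_div_iff₀ (by positivity) (by norm_num)]
      have h4 : (k : ℝ) * g ≤ (Q : ℝ) ^ 2 * (Q : ℝ) ^ 2 := by gcongr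
      have h5 : (Q : ℝ) ^ 2 * (Q : ℝ) ^ 2 ≤ (Q : ℝ) ^ 5 := by
        rw [← pow_add]
        exact pow_le_pow_right₀ hQr (by norm_num)
      linarith)
    (fun n _ => by
      have h1 := hdiff n
      have h2 := hdiff (n + 1)
      simp only [add_assoc n 1 1, one_add_one_eq_two] at h2
      rw [h1, h2]
      refine mul_le_mul_of_nonneg_left ?_ (by linarith)
      have := pyrRoot_second_diff_antitone (t := (n : ℝ) + i) g (by positivity) (by linarith)
      push_cast
      rwa [show (n : ℝ) + 1 + i = n + i + 1 by ring])
  refine main.trans ?_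
  simp only [hdiff]
  have hu := hupper (Q ^ 11) le_rfl
  have hkg : 1 ≤ (k : ℝ) * g := one_le_mul_of_one_le_of_one_le hkr hg1
  have hp6 : (Q : ℝ) ^ 6 ≤ (Q : ℝ) ^ 10 := pow_le_pow_right₀ hQr (by norm_num)
  have hp7 : (Q : ℝ) ^ 7 ≤ (Q : ℝ) ^ 10 := pow_le_pow_right₀ hQr (by norm_num)
  have t1 : 1 / (2 * l) ≤ 130 * (Q : ℝ) ^ 6 := by
    have : 1 / (2 * l) = 130 * (Q : ℝ) ^ 6 / (k * g) := by
      rw [hl]; field_simp; norm_num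
    rw [this]
    exact div_le_self (by positivity) hkg
  have t2 : k * g / (2 * (Q : ℝ) ^ 5) / (2 * l ^ 2) ≤ 16900 * (Q : ℝ) ^ 7 := by
    have : k * g / (2 * (Q : ℝ) ^ 5) / (2 * l ^ 2) = 16900 * (Q : ℝ) ^ 7 / (k * g) := by
      rw [hl]; field_simp; norm_num
    rw [this]
    exact div_le_self (by positivity) hkg
  have t3 := div_le_div_of_nonneg_right hu (by positivity : 0 ≤ 2 * l ^ 2)
  linarith [(by positivity : (0 : ℝ) ≤ (Q : ℝ) ^ 10)]

/-- Van der Corput with `H = Q ^ 2`: both `N² / H` and `N * B` are then of order `Q ^ 22`. -/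
theorem norm_sum_unitExp_pyrRoot_le {k Q N : ℕ} (hk : 1 ≤ k) (hkQ : k ≤ Q ^ 2)
    (hQ : 1 ≤ Q) (hN : Q ^ 12 ≤ N) (hN' : N ≤ 4096 * Q ^ 12) :
    ‖∑ n ∈ Ico (Q ^ 11) N, unitExp (k * pyrRoot n)‖ ≤ 20000 * (Q : ℝ) ^ 11 := by
  have hQr : (1 : ℝ) ≤ Q := by exact_mod_cast hQ
  have hNr : (N : ℝ) ≤ 4096 * (Q : ℝ) ^ 12 := by exact_mod_cast hN'
  have hMN : Q ^ 11 ≤ N := (Nat.pow_le_pow_right hQ (by norm_num)).trans hN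
  have h := norm_sum_Ico_le_of_correlations (fun n => unitExp (k * pyrRoot n))
    (fun n => (norm_unitExp _).le) hMN (pow_pos hQ 2) (by positivity)
    (fun i j hij hj => norm_sum_unitExp_pyrRoot_correlation_le hk hkQ hQ hN hN' hij hj)
  refine h.trans ?_
  have hs : Real.sqrt ((N : ℝ) ^ 2 / ((Q ^ 2 : ℕ) : ℝ) + N * (20000 * (Q : ℝ) ^ 10))
      ≤ 15000 * (Q : ℝ) ^ 11 := by
    refine Real.sqrt_le_iff.2 ⟨by positivity, ?_⟩
    have h1 : (N : ℝ) ^ 2 / ((Q ^ 2 : ℕ) : ℝ) ≤ (4096 * (Q : ℝ) ^ 12) ^ 2 / (Q : ℝ) ^ 2 := by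
      push_cast
      gcongr
    have h2 : (4096 * (Q : ℝ) ^ 12) ^ 2 / (Q : ℝ) ^ 2 = 4096 ^ 2 * (Q : ℝ) ^ 22 := by
      field_simp
    have h3 : (N : ℝ) * (20000 * (Q : ℝ) ^ 10) ≤ 4096 * (Q : ℝ) ^ 12 * (20000 * (Q : ℝ) ^ 10) := by
      gcongr
    nlinarith [(by positivity : (0 : ℝ) ≤ (Q : ℝ) ^ 22)]
  have hp : (Q : ℝ) ^ 2 ≤ (Q : ℝ) ^ 11 := pow_le_pow_right₀ hQr (by norm_num)
  push_cast at hs ⊢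
  linarith [(by positivity : (0 : ℝ) ≤ (Q : ℝ) ^ 11)]

/-! ### Fourier series of the distance to the nearest integer, and equidistribution. -/

theorem hasSum_cos_div_sq (t : ℝ) :
    HasSum (fun k : ℕ => 1 / (k : ℝ) ^ 2 * Real.cos (2 * Real.pi * (k * t)))
      (Real.pi ^ 2 * (Int.fract t ^ 2 - Int.fract t + 1 / 6)) := by
  have h := hasSum_one_div_nat_pow_mul_cos (k := 1) one_ne_zero
    (x := Int.fract t) ⟨Int.fract_nonneg t, (Int.fract_lt_one t).le⟩
  convert! h using 1
  · funext k
    have e : 2 * Real.pi * (k : ℝ) * Int.fract t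
        = 2 * Real.pi * (k * t) - ((k * ⌊t⌋ : ℤ) : ℝ) * (2 * Real.pi) := by
      rw [Int.fract]
      push_cast
      ring
    rw [e, Real.cos_sub_int_mul_two_pi]
  · have hB : (Polynomial.map (algebraMap ℚ ℝ) (Polynomial.bernoulli 2)).eval (Int.fract t)
        = Int.fract t ^ 2 - Int.fract t + 1 / 6 := by
      simp [Polynomial.bernoulli, Finset.sum_range_succ, bernoulli_two, bernoulli_one]
      ring
    simp only [mul_one]
    rw [hB, Nat.factorial_two]
    push_cast
    ring

/-- In `B₂({t}) - B₂({2t})/4` the quadratic terms cancel, leaving a piecewise linear tent. The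
absolutely convergent series of `B₂` thus yields that of the distance. -/
theorem abs_sub_round_sub_fourth_eq (t : ℝ) :
    |t - round t| - 1 / 4 = -2 * ((Int.fract t ^ 2 - Int.fract t + 1 / 6)
      - (Int.fract (2 * t) ^ 2 - Int.fract (2 * t) + 1 / 6) / 4) := by
  rw [abs_sub_round_eq_min]
  have h0 := Int.fract_nonneg t
  have h1 := Int.fract_lt_one t
  have hf := Int.floor_add_fract t
  rcases lt_or_ge (Int.fract t) (1 / 2) with h | h
  · have e : Int.fract (2 * t) = 2 * Int.fract t := by
      refine Int.fract_eq_iff.2 ⟨by linarith, by linarith, 2 * ⌊t⌋, ?_⟩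
      push_cast
      linarith
    rw [e, min_eq_left (by linarith)]
    ring
  · have e : Int.fract (2 * t) = 2 * Int.fract t - 1 := by
      refine Int.fract_eq_iff.2 ⟨by linarith, by linarith, 2 * ⌊t⌋ + 1, ?_⟩
      push_cast
      linarith
    rw [e, min_eq_right (by linarith)]
    ring

theorem hasSum_abs_sub_round (t : ℝ) :
    HasSum (fun k : ℕ => 1 / (k : ℝ) ^ 2 * (Real.cos (2 * Real.pi * (k * t))
        - Real.cos (2 * Real.pi * ((2 * k : ℕ) * t)) / 4))
      (-(Real.pi ^ 2 / 2) * (|t - round t| - 1 / 4)) := by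
  have h := (hasSum_cos_div_sq t).sub ((hasSum_cos_div_sq (2 * t)).div_const 4)
  convert! h using 1
  · funext k
    push_cast
    rw [show (2 : ℝ) * k * t = k * (2 * t) by ring]
    ring
  · rw [abs_sub_round_sub_fourth_eq]
    ring

/-- For `k > Q ^ 2` the trivial bound suffices, since `Q ≤ √k`. The loss of `√k` is affordable
because `∑ k⁻² √k` converges. -/
theorem abs_sum_cos_pyrRoot_le {k Q N : ℕ} (hk : 1 ≤ k)
    (hQ : 1 ≤ Q) (hN : Q ^ 12 ≤ N) (hN' : N ≤ 4096 * Q ^ 12) :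
    |∑ n ∈ Ico (Q ^ 11) N, Real.cos (2 * Real.pi * (k * pyrRoot n))|
      ≤ 20000 * (Q : ℝ) ^ 11 * Real.sqrt k := by
  have hQr : (1 : ℝ) ≤ Q := by exact_mod_cast hQ
  have hkr : (1 : ℝ) ≤ k := by exact_mod_cast hk
  rcases le_or_gt k (Q ^ 2) with h | h
  · have h1 := norm_sum_unitExp_pyrRoot_le hk h hQ hN hN'
    have h2 := Complex.abs_re_le_norm (∑ n ∈ Ico (Q ^ 11) N, unitExp (k * pyrRoot n))
    simp only [Complex.re_sum, re_unitExp] at h2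
    refine h2.trans (h1.trans ?_)
    exact le_mul_of_one_le_right (by positivity) (Real.one_le_sqrt.2 hkr)
  · have hs : (Q : ℝ) ≤ Real.sqrt k := Real.le_sqrt_of_sq_le (by exact_mod_cast h.le)
    have hNr : (N : ℝ) ≤ 4096 * (Q : ℝ) ^ 12 := by exact_mod_cast hN'
    calc _ ≤ ∑ n ∈ Ico (Q ^ 11) N, (1 : ℝ) :=
          (abs_sum_le_sum_abs _ _).trans (sum_le_sum fun _ _ => Real.abs_cos_le_one _)
      _ = ((N - Q ^ 11 : ℕ) : ℝ) := by simp
      _ ≤ N := by exact_mod_cast Nat.sub_le _ _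
      _ ≤ 20000 * (Q : ℝ) ^ 12 := by linarith [(by positivity : (0 : ℝ) ≤ (Q : ℝ) ^ 12)]
      _ = 20000 * (Q : ℝ) ^ 11 * Q := by ring
      _ ≤ _ := by gcongr

theorem summable_sqrt_div_sq : Summable fun k : ℕ => 1 / (k : ℝ) ^ 2 * Real.sqrt k := by
  refine (Real.summable_nat_rpow (p := -(3 / 2)).2 (by norm_num)).congr fun k => ?_
  rcases Nat.eq_zero_or_pos k with rfl | hk
  · norm_num
  · have hkr : (0 : ℝ) < k := by exact_mod_cast hk
    rw [Real.sqrt_eq_rpow, one_div, ← Real.rpow_natCast, ← Real.rpow_neg hkr.le,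
      ← Real.rpow_add hkr]
    norm_num

theorem exists_abs_sum_dist_pyrRoot_le :
    ∃ C : ℝ, 0 ≤ C ∧ ∀ N : ℕ,
      |∑ n ∈ range N, (|pyrRoot n - round (pyrRoot n)| - 1 / 4)| ≤ C * (N : ℝ) ^ (11 / 12 : ℝ) := by
  set Z : ℝ := ∑' k : ℕ, 1 / (k : ℝ) ^ 2 * Real.sqrt k with hZ
  have hZ0 : 0 ≤ Z := tsum_nonneg fun _ => by positivity
  refine ⟨40000 * Z + 1, by positivity, fun N => ?_⟩
  rcases Nat.eq_zero_or_pos N with rfl | hNpos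
  · simp
  have hN1 : (1 : ℝ) ≤ N := by exact_mod_cast hNpos
  -- Rounding down `N^(1/12)` loses at most a factor 2, hence `4096 = 2 ^ 12` in `hN'`.
  set Q : ℕ := ⌊(N : ℝ) ^ (1 / 12 : ℝ)⌋₊ with hQdef
  have hroot : ((N : ℝ) ^ (1 / 12 : ℝ)) ^ 12 = N := by
    rw [← Real.rpow_natCast, ← Real.rpow_mul (by linarith)]
    norm_num
  have hQ : 1 ≤ Q := Nat.one_le_floor_iff _ |>.2 (Real.one_le_rpow hN1 (by norm_num))
  have hQle : (Q : ℝ) ≤ (N : ℝ) ^ (1 / 12 : ℝ) := Nat.floor_le (by positivity)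
  have hN : Q ^ 12 ≤ N := by
    have : (Q : ℝ) ^ 12 ≤ N := by
      rw [← hroot]
      gcongr
    exact_mod_cast this
  have hN' : N ≤ 4096 * Q ^ 12 := by
    have h1 : (N : ℝ) ^ (1 / 12 : ℝ) ≤ Q + 1 := (Nat.lt_floor_add_one _).le
    have hQr : (1 : ℝ) ≤ Q := by exact_mod_cast hQ
    have : (N : ℝ) ≤ (2 * (Q : ℝ)) ^ 12 := by
      rw [← hroot]
      gcongr
      linarith
    rw [mul_pow] at this
    norm_num at this
    exact_mod_cast this
  have hQ11 : (Q : ℝ) ^ 11 ≤ (N : ℝ) ^ (11 / 12 : ℝ) := by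
    have e : (N : ℝ) ^ (11 / 12 : ℝ) = ((N : ℝ) ^ (1 / 12 : ℝ)) ^ 11 := by
      rw [← Real.rpow_natCast, ← Real.rpow_mul (by linarith)]
      norm_num
    rw [e]
    gcongr
  have hMN : Q ^ 11 ≤ N := (Nat.pow_le_pow_right hQ (by norm_num)).trans hN
  have hsum := hasSum_sum (s := Ico (Q ^ 11) N) fun n _ => hasSum_abs_sub_round (pyrRoot n)
  have hbound : |∑ n ∈ Ico (Q ^ 11) N,
      -(Real.pi ^ 2 / 2) * (|pyrRoot n - round (pyrRoot n)| - 1 / 4)|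
      ≤ 40000 * (Q : ℝ) ^ 11 * Z := by
    refine hsum.norm_le_of_bounded (summable_sqrt_div_sq.hasSum.mul_left _) fun k => ?_
    rcases Nat.eq_zero_or_pos k with rfl | hk
    · simp
    rw [← mul_sum, sum_sub_distrib, ← sum_div, norm_mul, Real.norm_of_nonneg (by positivity)]
    have h1 := abs_sum_cos_pyrRoot_le hk hQ hN hN'
    have h2 := abs_sum_cos_pyrRoot_le (k := 2 * k) (by omega) hQ hN hN'
    have h3 : Real.sqrt ((2 * k : ℕ) : ℝ) ≤ 2 * Real.sqrt k := by
      refine Real.sqrt_le_iff.2 ⟨by positivity, ?_⟩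
      rw [mul_pow, Real.sq_sqrt (by positivity)]
      push_cast
      linarith [(Nat.cast_nonneg k : (0 : ℝ) ≤ k)]
    have h4 := mul_le_mul_of_nonneg_left h3 (by positivity : 0 ≤ 20000 * (Q : ℝ) ^ 11)
    have h5 : 0 ≤ (Q : ℝ) ^ 11 * Real.sqrt k := by positivity
    have h6 : ∀ x y A : ℝ, |x| ≤ A → |y| ≤ 2 * A → ‖x - y / 4‖ ≤ 2 * A := fun x y A hx hy => by
      rw [Real.norm_eq_abs]
      have := abs_le.1 hx
      have := abs_le.1 hy
      exact abs_le.2 ⟨by linarith, by linarith⟩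
    have h7 := h6 _ _ _ h1 (h2.trans (by linarith))
    calc _ ≤ 1 / (k : ℝ) ^ 2 * (2 * (20000 * (Q : ℝ) ^ 11 * Real.sqrt k)) := by gcongr
      _ = _ := by ring
  rw [← mul_sum, abs_mul, abs_neg, abs_of_nonneg (by positivity)] at hbound
  have hpi : 1 ≤ Real.pi ^ 2 / 2 := by nlinarith [Real.pi_gt_three]
  have hhead : |∑ n ∈ range (Q ^ 11), (|pyrRoot n - round (pyrRoot n)| - 1 / 4)|
      ≤ (Q : ℝ) ^ 11 := by
    refine (abs_sum_le_sum_abs _ _).trans ((sum_le_sum (g := fun _ => (1 : ℝ)) fun n _ => ?_).trans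
      (by simp))
    have := abs_sub_round (pyrRoot n)
    exact abs_le.2 ⟨by linarith [abs_nonneg (pyrRoot n - round (pyrRoot n))], by linarith⟩
  have htail := (le_mul_of_one_le_left (abs_nonneg _) hpi).trans hbound
  rw [← sum_range_add_sum_Ico _ hMN]
  refine (abs_add_le _ _).trans ((add_le_add hhead htail).trans ?_)
  calc _ = (40000 * Z + 1) * (Q : ℝ) ^ 11 := by ring
    _ ≤ _ := by gcongr

/-! ### Comparing `a n` with the distance from `pyrRoot n` to the integers. -/

theorem abs_abs_sub_round_sub_le (s t : ℝ) :
    abs (|s - round s| - |t - round t|) ≤ |s - t| := by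
  have h1 := (round_le s (round t)).trans (abs_sub_le s t (round t))
  have h2 := (round_le t (round s)).trans (abs_sub_le t s (round s))
  rw [abs_sub_comm t s] at h2
  exact abs_le.2 ⟨by linarith, by linarith⟩

theorem cast_pyramidal (n : ℕ) :
    (Cannonball.pyramidal n : ℝ) = n * (n + 1) * (2 * n + 1) / 6 := by
  have h : (6 : ℝ) * Cannonball.pyramidal n = 2 * n ^ 3 + 3 * n ^ 2 + n := by
    exact_mod_cast Cannonball.six_mul_pyramidal n
  linarith

/-- `|s² - z²| = |s - z| (s + z)`. If `d` is the distance from `s` to the integers, the nearest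
integer gives at most `2sd + d²`, every natural number gives at least `2sd - d²`, and `d² ≤ 1/4`. -/
theorem abs_a_sub_sqrt_mul_dist_le (n : ℕ) :
    abs ((Cannonball.a n : ℝ) - 2 * Real.sqrt (Cannonball.pyramidal n) *
      |Real.sqrt (Cannonball.pyramidal n) - round (Real.sqrt (Cannonball.pyramidal n))|) ≤ 1 / 4 := by
  obtain ⟨y, hy, hmin⟩ := Cannonball.exists_a_eq n
  set s := Real.sqrt (Cannonball.pyramidal n) with hs
  have hs0 : 0 ≤ s := Real.sqrt_nonneg _
  have hsq : s ^ 2 = Cannonball.pyramidal n := Real.sq_sqrt (Nat.cast_nonneg _)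
  have hfac : ∀ z : ℕ, |(Cannonball.pyramidal n : ℝ) - (z : ℝ) ^ 2| = |s - z| * (s + z) := by
    intro z
    rw [← hsq, sq_sub_sq, abs_mul, abs_of_nonneg (by positivity : 0 ≤ s + z), mul_comm]
  have ha : (Cannonball.a n : ℝ) = |s - y| * (s + y) := by
    rw [← hfac]
    exact_mod_cast congrArg (Int.cast : ℤ → ℝ) hy
  have hmin' : (Cannonball.a n : ℝ) ≤ |s - (round s).toNat| * (s + (round s).toNat) := by
    rw [ha, ← hfac, ← hfac]
    exact_mod_cast hmin (round s).toNat
  have hr : (((round s).toNat : ℕ) : ℝ) = round s := by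
    have : 0 ≤ round s := by
      rw [round_eq]
      exact Int.floor_nonneg.2 (by linarith)
    exact_mod_cast Int.toNat_of_nonneg this
  rw [hr] at hmin'
  have hhalf := abs_sub_round s
  have hle := round_le s (y : ℤ)
  push_cast at hle
  have hd0 := abs_nonneg (s - round s)
  have hround : (round s : ℝ) ≤ s + |s - round s| := by
    linarith [neg_abs_le (s - round s)]
  have hy0 : (0 : ℝ) ≤ y := Nat.cast_nonneg y
  refine abs_le.2 ⟨?_, ?_⟩
  · rw [ha]
    rcases le_total s y with h | h
    · rw [abs_of_nonpos (by linarith : s - y ≤ 0)] at hle ⊢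
      nlinarith
    · rw [abs_of_nonneg (by linarith : 0 ≤ s - y)] at hle ⊢
      nlinarith
  · nlinarith

theorem pyrRoot_nonneg (n : ℕ) : 0 ≤ pyrRoot n := by
  rw [pyrRoot]
  positivity

theorem pyrRoot_sq (n : ℕ) : pyrRoot n ^ 2 = ((n : ℝ) + 1 / 2) ^ 3 / 3 := by
  rw [pyrRoot, div_pow, Real.sq_sqrt (by norm_num), ← Real.rpow_natCast, ← Real.rpow_mul
    (by positivity)]
  norm_num

/-- The shift by 1/2 makes `F² - s²` exactly `(n + 1/2)/12`, so `F (F - s) = O(n)`. The distance to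
the integers is 1-Lipschitz, so replacing `s` by `F` costs `O(n)`. -/
theorem abs_a_sub_pyrRoot_mul_dist_le (n : ℕ) :
    abs ((Cannonball.a n : ℝ) - 2 * pyrRoot n * |pyrRoot n - round (pyrRoot n)|) ≤ n + 1 := by
  have h1 := abs_a_sub_sqrt_mul_dist_le n
  set s := Real.sqrt (Cannonball.pyramidal n) with hs
  set F := pyrRoot n with hF
  have hs0 : 0 ≤ s := Real.sqrt_nonneg _
  have hF0 : 0 ≤ F := pyrRoot_nonneg n
  have hn0 : (0 : ℝ) ≤ n := Nat.cast_nonneg n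
  have hsq : s ^ 2 = n * (n + 1) * (2 * n + 1) / 6 := by
    rw [hs, Real.sq_sqrt (Nat.cast_nonneg _), cast_pyramidal]
  have hFsq : F ^ 2 = ((n : ℝ) + 1 / 2) ^ 3 / 3 := pyrRoot_sq n
  have hdiff : (F - s) * (F + s) = (n + 1 / 2) / 12 := by
    linear_combination hFsq - hsq
  have hsF : s ≤ F := by
    by_contra! h
    nlinarith
  have hdist := abs_abs_sub_round_sub_le s F
  rw [abs_of_nonpos (by linarith : s - F ≤ 0)] at hdist
  have hs2 := abs_sub_round s
  have hF2 := abs_sub_round F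
  have hds := abs_nonneg (s - round s)
  have hdF := abs_nonneg (F - round F)
  generalize |s - round s| = u at *
  generalize |F - round F| = v at *
  obtain ⟨h1a, h1b⟩ := abs_le.1 h1
  obtain ⟨hda, hdb⟩ := abs_le.1 hdist
  -- Uses `u ≤ u² + 1/4` for `u = F - s`, together with `u² ≤ (F - s) * (F + s)`.
  have hFs : F - s ≤ 1 / 4 + (n + 1 / 2) / 12 := by
    rcases le_total F (1 / 4) with h | h
    · linarith
    · nlinarith [sq_nonneg (F - s - 1 / 2)]
  have hFd : F * (F - s) ≤ (n + 1 / 2) / 12 := by nlinarith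
  have e : 2 * s * u - 2 * F * v = -2 * (F - s) * u + 2 * F * (u - v) := by ring
  have b1 : (F - s) * u ≤ (F - s) * (1 / 2) := mul_le_mul_of_nonneg_left hs2 (by linarith)
  have b2 : 0 ≤ (F - s) * u := mul_nonneg (by linarith) hds
  have b3 : F * (u - v) ≤ F * (F - s) := mul_le_mul_of_nonneg_left (by linarith) hF0
  have b4 : F * -(F - s) ≤ F * (u - v) := mul_le_mul_of_nonneg_left (by linarith) hF0
  exact abs_le.2 ⟨by linarith, by linarith⟩

theorem abs_pyrRoot_sub_rpow_le (n : ℕ) :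
    |pyrRoot n - (n : ℝ) ^ (3 / 2 : ℝ) / Real.sqrt 3| ≤ n + 1 := by
  have hn0 : (0 : ℝ) ≤ n := Nat.cast_nonneg n
  have hpow : ∀ t : ℝ, 0 ≤ t → t ^ (3 / 2 : ℝ) = Real.sqrt t ^ 3 := fun t ht => by
    rw [Real.sqrt_eq_rpow, ← Real.rpow_natCast, ← Real.rpow_mul ht]
    norm_num
  rw [pyrRoot, ← sub_div, abs_div, abs_of_nonneg (Real.sqrt_nonneg 3), hpow _ hn0,
    hpow _ (by positivity)]
  refine (div_le_self (abs_nonneg _) (by rw [Real.one_le_sqrt]; norm_num)).trans ?_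
  have hA : Real.sqrt ((n : ℝ) + 1 / 2) ^ 2 = n + 1 / 2 := Real.sq_sqrt (by positivity)
  have hB : Real.sqrt (n : ℝ) ^ 2 = n := Real.sq_sqrt hn0
  have hAB : Real.sqrt (n : ℝ) ≤ Real.sqrt ((n : ℝ) + 1 / 2) := Real.sqrt_le_sqrt (by linarith)
  have hB0 := Real.sqrt_nonneg (n : ℝ)
  generalize Real.sqrt ((n : ℝ) + 1 / 2) = A at *
  generalize Real.sqrt (n : ℝ) = B at *
  have hA2 : A ≤ n + 1 := by nlinarith [sq_nonneg (A - 1)]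
  rw [abs_of_nonneg (by nlinarith [pow_le_pow_left₀ hB0 hAB 3])]
  have e : A ^ 3 - B ^ 3 = (A - B) * (A + B) * (A + B) - (A - B) * (A * B) := by ring
  have e2 : (A - B) * (A + B) = 1 / 2 := by linear_combination hA - hB
  rw [e, e2]
  nlinarith [mul_nonneg (sub_nonneg.2 hAB) (mul_nonneg (hB0.trans hAB) hB0)]

/-- Splits the distance into its mean 1/4, which carries the main term, and an oscillating part. -/
theorem abs_a_sub_decomposition_le (n : ℕ) :
    |(Cannonball.a n : ℝ) - (2 * (pyrRoot n * (|pyrRoot n - round (pyrRoot n)| - 1 / 4))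
      + (n : ℝ) ^ (3 / 2 : ℝ) / Real.sqrt 3 / 2)| ≤ 2 * (n + 1) := by
  have h1 := abs_le.1 (abs_a_sub_pyrRoot_mul_dist_le n)
  have h2 := abs_le.1 (abs_pyrRoot_sub_rpow_le n)
  exact abs_le.2 ⟨by nlinarith, by nlinarith⟩

/-! ### Partial summation and the asymptotics for `a`. -/

/-- Abel summation: the increments of a monotone weight telescope. -/
theorem abs_sum_monotone_mul_le {w g : ℕ → ℝ} (hw : Monotone w) (hw0 : 0 ≤ w 0) {N : ℕ} {E : ℝ}
    (hE : ∀ K ≤ N, |∑ n ∈ range K, g n| ≤ E) :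
    |∑ n ∈ range N, w n * g n| ≤ 2 * w N * E := by
  have hE0 : 0 ≤ E := (abs_nonneg _).trans (hE N le_rfl)
  have key : ∀ K ≤ N, |∑ n ∈ range K, w n * g n - w K * ∑ n ∈ range K, g n| ≤ (w K - w 0) * E := by
    intro K
    induction K with
    | zero => simp
    | succ K ih =>
      intro hK
      have e : ∑ n ∈ range (K + 1), w n * g n - w (K + 1) * ∑ n ∈ range (K + 1), g n
          = (∑ n ∈ range K, w n * g n - w K * ∑ n ∈ range K, g n)
            + (w K - w (K + 1)) * ∑ n ∈ range (K + 1), g n := by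
        rw [sum_range_succ, sum_range_succ]
        ring
      rw [e]
      refine (abs_add_le _ _).trans ((add_le_add (ih (by omega)) ?_).trans
        (le_of_eq (by ring : _ + (w (K + 1) - w K) * E = _)))
      have hm := hw (Nat.le_succ K)
      rw [abs_mul, abs_sub_comm, abs_of_nonneg (sub_nonneg.2 hm)]
      exact mul_le_mul_of_nonneg_left (hE _ hK) (sub_nonneg.2 hm)
  have hwN : 0 ≤ w N := hw0.trans (hw (Nat.zero_le N))
  have h2 : |w N * ∑ n ∈ range N, g n| ≤ w N * E := by
    rw [abs_mul, abs_of_nonneg hwN]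
    exact mul_le_mul_of_nonneg_left (hE N le_rfl) hwN
  have h3 := key N le_rfl
  have h4 : 0 ≤ w 0 * E := mul_nonneg hw0 hE0
  have h5 := abs_sub_abs_le_abs_sub (∑ n ∈ range N, w n * g n) (w N * ∑ n ∈ range N, g n)
  nlinarith

theorem monotone_pyrRoot : Monotone fun n : ℕ => pyrRoot n := fun m n h => by
  have : (m : ℝ) ≤ n := by exact_mod_cast h
  simp only [pyrRoot]
  gcongr

theorem abs_sum_rpow_sub_le {p X : ℝ} (hp : 0 < p) (hX : 1 ≤ X) :
    |∑ n ∈ range (⌊X⌋₊ + 1), (n : ℝ) ^ p - X ^ (p + 1) / (p + 1)| ≤ 2 ^ p * X ^ p := by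
  set N := ⌊X⌋₊ with hN
  have hNX : (N : ℝ) ≤ X := Nat.floor_le (by linarith)
  have hXN : X ≤ N + 1 := (Nat.lt_floor_add_one X).le
  have hN0 : (0 : ℝ) ≤ N := Nat.cast_nonneg N
  have hmono : ∀ b : ℝ, MonotoneOn (fun t : ℝ => t ^ p) (Set.Icc 0 b) := fun b s hs t _ hst =>
    Real.rpow_le_rpow hs.1 hst hp.le
  have hint : ∀ K : ℕ, ∫ t in (0 : ℝ)..(0 + K), t ^ p = (K : ℝ) ^ (p + 1) / (p + 1) := by
    intro K
    rw [integral_rpow (Or.inl (by linarith)), zero_add, Real.zero_rpow (by linarith), sub_zero]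
  have hup := MonotoneOn.sum_le_integral (x₀ := 0) (a := N) (hmono _)
  have hlo := MonotoneOn.integral_le_sum (x₀ := 0) (a := N + 1) (hmono _)
  rw [hint] at hup hlo
  simp only [zero_add] at hup hlo
  rw [sum_range_succ (fun i : ℕ => ((i + 1 : ℕ) : ℝ) ^ p)] at hlo
  have hshift : ∑ n ∈ range (N + 1), (n : ℝ) ^ p = ∑ n ∈ range N, ((n + 1 : ℕ) : ℝ) ^ p := by
    rw [sum_range_succ']
    simp [Real.zero_rpow hp.ne']
  have h2 : (1 : ℝ) ≤ 2 ^ p := Real.one_le_rpow (by norm_num) hp.le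
  have hXp : 0 ≤ X ^ p := by positivity
  refine abs_le.2 ⟨?_, ?_⟩
  · rw [hshift]
    have h3 : ((N + 1 : ℕ) : ℝ) ^ p ≤ 2 ^ p * X ^ p := by
      rw [← Real.mul_rpow (by norm_num) (by linarith)]
      refine Real.rpow_le_rpow (by positivity) ?_ hp.le
      push_cast
      linarith
    have h4 : X ^ (p + 1) / (p + 1) ≤ ((N + 1 : ℕ) : ℝ) ^ (p + 1) / (p + 1) := by
      push_cast
      gcongr
    linarith
  · rw [sum_range_succ]
    have h3 : (N : ℝ) ^ p ≤ X ^ p := Real.rpow_le_rpow hN0 hNX hp.le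
    have h4 : (N : ℝ) ^ (p + 1) / (p + 1) ≤ X ^ (p + 1) / (p + 1) := by gcongr
    nlinarith

theorem a_zero : Cannonball.a 0 = 0 := by
  have h : Cannonball.a 0 ∈ {m | m ≤ 0} :=
    Nat.sInf_le ⟨0, by simp [Cannonball.pyramidal]⟩
  exact Nat.le_zero.1 h

theorem exists_abs_sum_a_sub_le :
    ∃ C : ℝ, 0 ≤ C ∧ ∀ X : ℝ, 1 ≤ X →
      |∑ n ∈ Icc 1 ⌊X⌋₊, (Cannonball.a n : ℝ) * (1 - n / X)
        - 2 / (35 * Real.sqrt 3) * X ^ (5 / 2 : ℝ)| ≤ C * X ^ (29 / 12 : ℝ) := by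
  obtain ⟨C, hC0, hC⟩ := exists_abs_sum_dist_pyrRoot_le
  -- `216 = 2 * 36 + 2 * 72` collects the two oscillating sums, weighted by `pyrRoot n` and `n *
  -- pyrRoot n / X`. The main-term and remainder errors, at most 12 each, fit in the rest.
  refine ⟨216 * C + 18 + 12, by positivity, fun X hX => ?_⟩
  have hX0 : 0 < X := by linarith
  set N := ⌊X⌋₊ with hN
  have hNX : (N : ℝ) ≤ X := Nat.floor_le hX0.le
  set g : ℕ → ℝ := fun n => |pyrRoot n - round (pyrRoot n)| - 1 / 4 with hg
  set r : ℕ → ℝ := fun n => (Cannonball.a n : ℝ) - (2 * (pyrRoot n * g n)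
      + (n : ℝ) ^ (3 / 2 : ℝ) / Real.sqrt 3 / 2) with hr
  have hrange : ∑ n ∈ Icc 1 N, (Cannonball.a n : ℝ) * (1 - n / X)
      = ∑ n ∈ range (N + 1), (Cannonball.a n : ℝ) * (1 - n / X) := by
    refine sum_subset (fun n hn => ?_) fun n hn hn' => ?_
    · simp only [mem_Icc, mem_range] at hn ⊢
      omega
    · have h0 : n = 0 := by
        simp only [mem_Icc, mem_range] at hn hn'
        omega
      rw [h0, a_zero, Nat.cast_zero, zero_mul]
  have hE : ∀ K ≤ N + 1, |∑ n ∈ range K, g n| ≤ 2 * C * X ^ (11 / 12 : ℝ) := by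
    intro K hK
    refine (hC K).trans ?_
    have hKr : (K : ℝ) ≤ 2 * X := by
      have : (K : ℝ) ≤ N + 1 := by exact_mod_cast hK
      linarith
    have h1 : (K : ℝ) ^ (11 / 12 : ℝ) ≤ 2 * X ^ (11 / 12 : ℝ) := by
      refine (Real.rpow_le_rpow (by positivity) hKr (by norm_num)).trans ?_
      rw [Real.mul_rpow (by norm_num) hX0.le]
      gcongr
      exact (Real.rpow_le_rpow_of_exponent_le (by norm_num) (by norm_num : (11 / 12 : ℝ) ≤ 1)).trans
        (by norm_num)
    nlinarith
  have hF : pyrRoot ((N + 1 : ℕ) : ℝ) ≤ 9 * X ^ (3 / 2 : ℝ) := by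
    rw [pyrRoot]
    refine (div_le_self (by positivity) (by rw [Real.one_le_sqrt]; norm_num)).trans ?_
    have h3 : ((N + 1 : ℕ) : ℝ) + 1 / 2 ≤ 3 * X := by push_cast; linarith
    refine (Real.rpow_le_rpow (by positivity) h3 (by norm_num)).trans ?_
    rw [Real.mul_rpow (by norm_num) hX0.le]
    gcongr
    refine (Real.rpow_le_rpow_of_exponent_le (by norm_num) (by norm_num : (3 / 2 : ℝ) ≤ 2)).trans ?_
    norm_num
  have hX29 : X ^ (3 / 2 : ℝ) * X ^ (11 / 12 : ℝ) = X ^ (29 / 12 : ℝ) := by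
    rw [← Real.rpow_add hX0]
    norm_num
  have hX32 : X ^ (3 / 2 : ℝ) ≤ X ^ (29 / 12 : ℝ) :=
    Real.rpow_le_rpow_of_exponent_le hX (by norm_num)
  have hX2 : X ^ 2 ≤ X ^ (29 / 12 : ℝ) := by
    rw [← Real.rpow_natCast]
    exact Real.rpow_le_rpow_of_exponent_le hX (by norm_num)
  have hfluct₁ : |∑ n ∈ range (N + 1), pyrRoot n * g n| ≤ 36 * C * X ^ (29 / 12 : ℝ) := by
    refine (abs_sum_monotone_mul_le monotone_pyrRoot (pyrRoot_nonneg 0) hE).trans ?_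
    calc _ ≤ 2 * (9 * X ^ (3 / 2 : ℝ)) * (2 * C * X ^ (11 / 12 : ℝ)) := by gcongr
      _ = 36 * C * (X ^ (3 / 2 : ℝ) * X ^ (11 / 12 : ℝ)) := by ring
      _ = _ := by rw [hX29]
  have hfluct₂ : |∑ n ∈ range (N + 1), n * pyrRoot n * g n| ≤ 72 * C * X ^ (29 / 12 : ℝ) * X := by
    have hm : Monotone fun n : ℕ => (n : ℝ) * pyrRoot n := fun m n h => by
      have h1 : (m : ℝ) ≤ n := by exact_mod_cast h
      exact mul_le_mul h1 (monotone_pyrRoot h) (pyrRoot_nonneg m) (Nat.cast_nonneg n)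
    refine (abs_sum_monotone_mul_le hm (by simp) hE).trans ?_
    have hN2 : ((N + 1 : ℕ) : ℝ) ≤ 2 * X := by push_cast; linarith
    have := pyrRoot_nonneg (N + 1)
    calc _ ≤ 2 * (2 * X * (9 * X ^ (3 / 2 : ℝ))) * (2 * C * X ^ (11 / 12 : ℝ)) := by gcongr
      _ = 72 * C * (X ^ (3 / 2 : ℝ) * X ^ (11 / 12 : ℝ)) * X := by ring
      _ = _ := by rw [hX29]
  have hrem : |∑ n ∈ range (N + 1), r n * (1 - n / X)| ≤ 12 * X ^ (29 / 12 : ℝ) := by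
    have h1 : ∀ n ∈ range (N + 1), |r n * (1 - n / X)| ≤ 2 * (2 * X) := by
      intro n hn
      have hnX : (n : ℝ) ≤ X :=
        le_trans (by exact_mod_cast Nat.lt_succ_iff.1 (mem_range.1 hn)) hNX
      have h2 : 0 ≤ n / X := by positivity
      have h3 : n / X ≤ 1 := (div_le_one hX0).2 hnX
      rw [abs_mul, abs_of_nonneg (sub_nonneg.2 h3)]
      refine (mul_le_of_le_one_right (abs_nonneg _) (by linarith)).trans
        ((abs_a_sub_decomposition_le n).trans (by linarith))
    refine (abs_sum_le_sum_abs _ _).trans ((sum_le_sum h1).trans ?_)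
    rw [sum_const, card_range, nsmul_eq_mul]
    push_cast
    nlinarith
  have hm₁ := abs_sum_rpow_sub_le (p := 3 / 2) (by norm_num) hX
  have hm₂ := abs_sum_rpow_sub_le (p := 5 / 2) (by norm_num) hX
  rw [← hN] at hm₁ hm₂
  have h2a : (2 : ℝ) ^ (3 / 2 : ℝ) ≤ 4 :=
    (Real.rpow_le_rpow_of_exponent_le (by norm_num) (by norm_num : (3 / 2 : ℝ) ≤ 2)).trans
      (by norm_num)
  have h2b : (2 : ℝ) ^ (5 / 2 : ℝ) ≤ 8 :=
    (Real.rpow_le_rpow_of_exponent_le (by norm_num) (by norm_num : (5 / 2 : ℝ) ≤ 3)).trans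
      (by norm_num)
  have hX52 : X ^ (5 / 2 : ℝ) = X ^ (3 / 2 : ℝ) * X := by
    rw [← Real.rpow_add_one hX0.ne']
    norm_num
  have hX72 : X ^ (5 / 2 + 1 : ℝ) = X ^ (5 / 2 : ℝ) * X := Real.rpow_add_one hX0.ne' _
  set M₁ := ∑ n ∈ range (N + 1), (n : ℝ) ^ (3 / 2 : ℝ)
  set M₂ := ∑ n ∈ range (N + 1), (n : ℝ) ^ (5 / 2 : ℝ)
  have hM₁ : |M₁ - 2 / 5 * X ^ (5 / 2 : ℝ)| ≤ 4 * X ^ (29 / 12 : ℝ) := by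
    norm_num at hm₁
    rw [show 2 / 5 * X ^ (5 / 2 : ℝ) = X ^ (5 / 2 : ℝ) / (5 / 2) by ring]
    refine hm₁.trans (mul_le_mul h2a hX32 (by positivity) (by norm_num))
  have hM₂ : |M₂ / X - 2 / 7 * X ^ (5 / 2 : ℝ)| ≤ 8 * X ^ (29 / 12 : ℝ) := by
    have e : M₂ / X - 2 / 7 * X ^ (5 / 2 : ℝ)
        = (M₂ - X ^ (5 / 2 + 1 : ℝ) / (5 / 2 + 1)) / X := by
      rw [hX72]
      field_simp
      ring
    rw [e, abs_div, abs_of_pos hX0, div_le_iff₀ hX0]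
    refine hm₂.trans ?_
    rw [hX52, ← mul_assoc]
    gcongr
  have hs3 : 1 ≤ Real.sqrt 3 := by rw [Real.one_le_sqrt]; norm_num
  have hmain : |(M₁ - M₂ / X) / (2 * Real.sqrt 3) - 2 / (35 * Real.sqrt 3) * X ^ (5 / 2 : ℝ)|
      ≤ 12 * X ^ (29 / 12 : ℝ) := by
    have e : (M₁ - M₂ / X) / (2 * Real.sqrt 3) - 2 / (35 * Real.sqrt 3) * X ^ (5 / 2 : ℝ)
        = ((M₁ - 2 / 5 * X ^ (5 / 2 : ℝ)) - (M₂ / X - 2 / 7 * X ^ (5 / 2 : ℝ)))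
          / (2 * Real.sqrt 3) := by
      field_simp
      ring
    rw [e, abs_div, abs_of_pos (by positivity : 0 < 2 * Real.sqrt 3)]
    refine (div_le_self (abs_nonneg _) (by linarith)).trans ?_
    have c1 := abs_le.1 hM₁
    have c2 := abs_le.1 hM₂
    exact abs_le.2 ⟨by linarith, by linarith⟩
  have hsplit : ∑ n ∈ range (N + 1), (Cannonball.a n : ℝ) * (1 - n / X)
      = 2 * (∑ n ∈ range (N + 1), pyrRoot n * g n)
        - 2 * (∑ n ∈ range (N + 1), n * pyrRoot n * g n) / X
        + (M₁ - M₂ / X) / (2 * Real.sqrt 3) + ∑ n ∈ range (N + 1), r n * (1 - n / X) := by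
    simp only [M₁, M₂, mul_sum, sum_div, ← sum_sub_distrib, ← sum_add_distrib]
    refine sum_congr rfl fun n _ => ?_
    have e : (n : ℝ) ^ (5 / 2 : ℝ) = (n : ℝ) ^ (3 / 2 : ℝ) * n := by
      rw [show (5 / 2 : ℝ) = 3 / 2 + 1 by norm_num,
        Real.rpow_add_one' (Nat.cast_nonneg n) (by norm_num)]
    simp only [hr, e]
    field_simp
    ring
  have hf₂ : |(∑ n ∈ range (N + 1), n * pyrRoot n * g n) / X| ≤ 72 * C * X ^ (29 / 12 : ℝ) := by
    rw [abs_div, abs_of_pos hX0, div_le_iff₀ hX0]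
    exact hfluct₂
  rw [hrange, hsplit, mul_div_assoc]
  have b1 := abs_le.1 hfluct₁
  have b2 := abs_le.1 hf₂
  have b3 := abs_le.1 hmain
  have b4 := abs_le.1 hrem
  have b5 : 0 ≤ X ^ (29 / 12 : ℝ) := by positivity
  exact abs_le.2 ⟨by linarith, by linarith⟩

/-! ### From `a` to `b`, and the zeta value. -/

theorem sum_Icc_sum_divisors_eq (h : ℕ → ℕ → ℝ) (N : ℕ) :
    ∑ n ∈ Icc 1 N, ∑ d ∈ n.divisors, h d n = ∑ m ∈ Icc 1 N, ∑ d ∈ Icc 1 (N / m), h d (d * m) := by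
  rw [sum_sigma', sum_sigma']
  refine sum_bij' (fun p _ => ⟨p.1 / p.2, p.2⟩) (fun p _ => ⟨p.2 * p.1, p.2⟩) ?_ ?_ ?_ ?_ ?_
  · rintro ⟨n, d⟩ hp
    simp only [mem_sigma, mem_Icc, Nat.mem_divisors] at hp ⊢
    obtain ⟨⟨h1, h2⟩, ⟨m, rfl⟩, -⟩ := hp
    have hd : 0 < d := Nat.pos_of_mul_pos_right h1
    have hm : 0 < m := Nat.pos_of_mul_pos_left h1
    rw [Nat.mul_div_cancel_left m hd]
    exact ⟨⟨hm, (Nat.le_mul_of_pos_left m hd).trans h2⟩, hd, (Nat.le_div_iff_mul_le hm).2 h2⟩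
  · rintro ⟨m, d⟩ hp
    simp only [mem_sigma, mem_Icc, Nat.mem_divisors] at hp ⊢
    obtain ⟨⟨h1, -⟩, h3, h4⟩ := hp
    have hdm : 0 < d * m := Nat.mul_pos h3 h1
    exact ⟨⟨hdm, (Nat.le_div_iff_mul_le h1).1 h4⟩, Dvd.intro _ rfl, hdm.ne'⟩
  · rintro ⟨n, d⟩ hp
    simp only [mem_sigma, Nat.mem_divisors] at hp
    simp only [Nat.mul_div_cancel' hp.2.1]
  · rintro ⟨m, d⟩ hp
    simp only [mem_sigma, mem_Icc] at hp
    simp only [Nat.mul_div_cancel_left m hp.2.1]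
  · rintro ⟨n, d⟩ hp
    simp only [mem_sigma, Nat.mem_divisors] at hp
    simp only [Nat.mul_div_cancel' hp.2.1]

/-- Writing `n = d * m`, the weight depends only on `d * m / x = d / (x / m)`, so each inner sum is
the weighted sum of `a` at `x / m`. -/
theorem sum_b_eq {x : ℝ} (hx : 1 ≤ x) :
    ∑ n ∈ Icc 1 ⌊x⌋₊, (Cannonball.b n : ℝ) * (1 - (n : ℝ) / x)
      = ∑ m ∈ Icc 1 ⌊x⌋₊, ∑ d ∈ Icc 1 ⌊x / m⌋₊, (Cannonball.a d : ℝ) * (1 - d / (x / m)) := by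
  have h := sum_Icc_sum_divisors_eq (fun d n => (Cannonball.a d : ℝ) * (1 - (n : ℝ) / x)) ⌊x⌋₊
  calc _ = ∑ n ∈ Icc 1 ⌊x⌋₊, ∑ d ∈ n.divisors, (Cannonball.a d : ℝ) * (1 - (n : ℝ) / x) := by
        refine sum_congr rfl fun n _ => ?_
        rw [Cannonball.b, Nat.cast_sum, sum_mul]
    _ = _ := h
    _ = _ := by
        refine sum_congr rfl fun m hm => ?_
        have hm0 : (m : ℝ) ≠ 0 := by
          have := (mem_Icc.1 hm).1
          positivity
        rw [Nat.floor_div_natCast]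
        refine sum_congr rfl fun d _ => ?_
        push_cast
        congr 2
        field_simp

/-- In the tail `m ≥ x`, hence `m^(-5/2) ≤ m^(-3/2) / x` termwise. -/
theorem abs_sum_Icc_one_div_rpow_sub_tsum_le {x : ℝ} (hx : 1 ≤ x) :
    |∑ m ∈ Icc 1 ⌊x⌋₊, 1 / (m : ℝ) ^ (5 / 2 : ℝ) - ∑' m : ℕ, 1 / (m : ℝ) ^ (5 / 2 : ℝ)|
      ≤ (∑' m : ℕ, 1 / (m : ℝ) ^ (3 / 2 : ℝ)) / x := by
  have hx0 : 0 < x := by linarith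
  have hs : Summable fun m : ℕ => 1 / (m : ℝ) ^ (5 / 2 : ℝ) :=
    Real.summable_one_div_nat_rpow.2 (by norm_num)
  have hs' : Summable fun m : ℕ => 1 / (m : ℝ) ^ (3 / 2 : ℝ) :=
    Real.summable_one_div_nat_rpow.2 (by norm_num)
  have hfin := hasSum_sum_of_ne_finset_zero (L := SummationFilter.unconditional ℕ)
    (f := fun m : ℕ => if m ∈ Icc 1 ⌊x⌋₊ then 1 / (m : ℝ) ^ (5 / 2 : ℝ) else 0)
    (s := Icc 1 ⌊x⌋₊) (fun m hm => if_neg hm)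
  rw [sum_congr rfl fun m hm => if_pos hm] at hfin
  refine (hfin.sub hs.hasSum).norm_le_of_bounded (hs'.hasSum.div_const x) fun m => ?_
  split_ifs with hm
  · rw [sub_self, norm_zero]
    positivity
  · rw [zero_sub, norm_neg, Real.norm_of_nonneg (by positivity)]
    -- The term `m = 0` of the series is 0, by the convention `1 / 0 = 0`.
    rcases Nat.eq_zero_or_pos m with rfl | hm0
    · norm_num
    have hmr : (0 : ℝ) < m := by exact_mod_cast hm0
    have hxm : x ≤ m := by
      have : ⌊x⌋₊ < m := by
        by_contra! hle
        exact hm (mem_Icc.2 ⟨hm0, hle⟩)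
      exact ((Nat.floor_lt hx0.le).1 this).le
    have e : (m : ℝ) ^ (5 / 2 : ℝ) = (m : ℝ) ^ (3 / 2 : ℝ) * m := by
      rw [← Real.rpow_add_one hmr.ne']
      norm_num
    rw [e, div_div]
    gcongr

theorem exists_abs_sum_b_sub_le :
    ∃ C : ℝ, 0 ≤ C ∧ ∀ x : ℝ, 1 ≤ x →
      |∑ n ∈ Icc 1 ⌊x⌋₊, (Cannonball.b n : ℝ) * (1 - (n : ℝ) / x)
        - 2 / (35 * Real.sqrt 3) * (∑' m : ℕ, 1 / (m : ℝ) ^ (5 / 2 : ℝ)) * x ^ (5 / 2 : ℝ)|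
        ≤ C * x ^ (29 / 12 : ℝ) := by
  obtain ⟨C, hC0, hC⟩ := exists_abs_sum_a_sub_le
  set Z₁ := ∑' m : ℕ, 1 / (m : ℝ) ^ (29 / 12 : ℝ)
  set Z₂ := ∑' m : ℕ, 1 / (m : ℝ) ^ (3 / 2 : ℝ)
  set Z := ∑' m : ℕ, 1 / (m : ℝ) ^ (5 / 2 : ℝ)
  have hZ₁ : 0 ≤ Z₁ := tsum_nonneg fun _ => by positivity
  have hZ₂ : 0 ≤ Z₂ := tsum_nonneg fun _ => by positivity
  set c : ℝ := 2 / (35 * Real.sqrt 3) with hc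
  have hc0 : 0 ≤ c := by positivity
  refine ⟨C * Z₁ + c * Z₂, by positivity, fun x hx => ?_⟩
  have hx0 : 0 < x := by linarith
  rw [sum_b_eq hx]
  set N := ⌊x⌋₊ with hN
  have hmem : ∀ m ∈ Icc 1 N, (0 : ℝ) < m ∧ 1 ≤ x / m := by
    intro m hm
    obtain ⟨h1, h2⟩ := mem_Icc.1 hm
    have hm0 : (0 : ℝ) < m := by exact_mod_cast h1
    exact ⟨hm0, (one_le_div hm0).2 ((Nat.le_floor_iff hx0.le).1 h2)⟩
  have h1 : |∑ m ∈ Icc 1 N, (∑ d ∈ Icc 1 ⌊x / m⌋₊, (Cannonball.a d : ℝ) * (1 - d / (x / m))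
      - c * (x / m) ^ (5 / 2 : ℝ))| ≤ C * Z₁ * x ^ (29 / 12 : ℝ) := by
    refine (abs_sum_le_sum_abs _ _).trans ((sum_le_sum fun m hm => hC _ (hmem m hm).2).trans ?_)
    have h2 : ∑ m ∈ Icc 1 N, 1 / (m : ℝ) ^ (29 / 12 : ℝ) ≤ Z₁ :=
      (Real.summable_one_div_nat_rpow.2 (by norm_num)).sum_le_tsum _ fun _ _ => by positivity
    calc _ = C * x ^ (29 / 12 : ℝ) * ∑ m ∈ Icc 1 N, 1 / (m : ℝ) ^ (29 / 12 : ℝ) := by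
          rw [mul_sum]
          refine sum_congr rfl fun m hm => ?_
          rw [Real.div_rpow hx0.le (hmem m hm).1.le]
          ring
      _ ≤ C * x ^ (29 / 12 : ℝ) * Z₁ := by gcongr
      _ = _ := by ring
  have h3 : ∑ m ∈ Icc 1 N, c * (x / m) ^ (5 / 2 : ℝ)
      = c * x ^ (5 / 2 : ℝ) * ∑ m ∈ Icc 1 N, 1 / (m : ℝ) ^ (5 / 2 : ℝ) := by
    rw [mul_sum]
    refine sum_congr rfl fun m hm => ?_
    rw [Real.div_rpow hx0.le (hmem m hm).1.le]
    ring
  have h4 := abs_sum_Icc_one_div_rpow_sub_tsum_le hx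
  rw [sum_sub_distrib, h3] at h1
  set W := ∑ m ∈ Icc 1 N, 1 / (m : ℝ) ^ (5 / 2 : ℝ)
  have h5 : |c * x ^ (5 / 2 : ℝ) * (W - Z)| ≤ c * Z₂ * x ^ (29 / 12 : ℝ) := by
    rw [abs_mul, abs_of_nonneg (by positivity)]
    calc _ ≤ c * x ^ (5 / 2 : ℝ) * (Z₂ / x) := by gcongr
      _ = c * Z₂ * x ^ (3 / 2 : ℝ) := by
          rw [show (5 / 2 : ℝ) = 3 / 2 + 1 by norm_num, Real.rpow_add_one hx0.ne']
          field_simp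
      _ ≤ _ := by
          exact mul_le_mul_of_nonneg_left
            (Real.rpow_le_rpow_of_exponent_le hx (by norm_num)) (by positivity)
  have b1 := abs_le.1 h1
  have b2 := abs_le.1 h5
  exact abs_le.2 ⟨by linarith, by linarith⟩

theorem riemannZeta_five_halves :
    riemannZeta (5 / 2) = ((∑' m : ℕ, 1 / (m : ℝ) ^ (5 / 2 : ℝ) : ℝ) : ℂ) := by
  rw [zeta_eq_tsum_one_div_nat_cpow (by norm_num), Complex.ofReal_tsum]
  refine tsum_congr fun m => ?_
  rw [Complex.ofReal_div, Complex.ofReal_one, Complex.ofReal_cpow (Nat.cast_nonneg m)]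
  norm_num

theorem theorem1p3 (δ : ℝ) (hδ : 0 < δ) :
    ∃ C : ℝ, ∀ x : ℝ, 1 ≤ x →
      ‖((x * ∑ n ∈ Finset.Icc 1 ⌊x⌋₊, (Cannonball.b n : ℝ) * (1 - (n : ℝ) / x) : ℝ) : ℂ)
          - 2 * riemannZeta (5 / 2) / (35 * (Real.sqrt 3 : ℂ)) * ((x ^ (7 / 2 : ℝ) : ℝ) : ℂ)‖
        ≤ C * x ^ (41 / 12 + δ) := by
  obtain ⟨C, hC0, hC⟩ := exists_abs_sum_b_sub_le
  refine ⟨C, fun x hx => ?_⟩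
  have hx0 : 0 < x := by linarith
  set Z := ∑' m : ℕ, 1 / (m : ℝ) ^ (5 / 2 : ℝ) with hZ
  set S := ∑ n ∈ Finset.Icc 1 ⌊x⌋₊, (Cannonball.b n : ℝ) * (1 - (n : ℝ) / x) with hS
  have e : ((x * S : ℝ) : ℂ)
      - 2 * riemannZeta (5 / 2) / (35 * (Real.sqrt 3 : ℂ)) * ((x ^ (7 / 2 : ℝ) : ℝ) : ℂ)
      = ((x * (S - 2 / (35 * Real.sqrt 3) * Z * x ^ (5 / 2 : ℝ)) : ℝ) : ℂ) := by
    rw [riemannZeta_five_halves, ← hZ, show (7 / 2 : ℝ) = 5 / 2 + 1 by norm_num,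
      Real.rpow_add_one hx0.ne']
    push_cast
    ring
  rw [e, Complex.norm_real, norm_mul, Real.norm_of_nonneg hx0.le]
  calc _ ≤ x * (C * x ^ (29 / 12 : ℝ)) := mul_le_mul_of_nonneg_left (hC x hx) hx0.le
    _ = C * x ^ (41 / 12 : ℝ) := by
        rw [show (41 / 12 : ℝ) = 29 / 12 + 1 by norm_num, Real.rpow_add_one hx0.ne']
        ring
    -- The estimate already holds with exponent `41/12`; as `x ≥ 1`, adding `δ` only weakens it.
    _ ≤ _ := by
        exact mul_le_mul_of_nonneg_left
          (Real.rpow_le_rpow_of_exponent_le hx (by linarith)) hC0
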